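/- Let $n\ge 1$ be an integer, put $\lambda_n=n^2$, and let $T_n$ and $U_{n-1}$ be the Chebyshev polynomials of the first and second kind. Consider the Chebyshev differential equation $$y''-\frac{x}{1-x^{2}}\,y'+\frac{\lambda_n}{1-x^{2}}\,y=0 .$$ 1. Let $K=\mathbb{C}(x)$ with the derivation $d/dx$. A Picard--Vessiot extension of $K$ for this equation is a differential field extension $L/K$ that has no constants other than those of $K$ and is generated over $K$, as a differential field, by two solutions that are linearly independent over the constants. Such an extension exists, and for every such $L$ the differential Galois group $G(L/K)$, i.e. the group of $K$-automorphisms of $L$ that commute with the derivation, is isomorphic to $\mathbb{Z}_2$. 2. Let $\Omega\subseteq\mathbb{C}$ be a nonempty open set and $\sqrt{1-x^2}$ a holomorphic branch of the square root on $\Omega$. By a first integral of a vector field on a nonempty open set $D\subseteq\mathbb{C}^2$ we mean a holomorphic function on $D$ whose derivative along the vector field vanishes on $D$ and which is not constant on any nonempty open subset of $D$. (a) On the set of all $(w,x)\in\mathbb{C}\times\Omega$ at which none of the denominators below vanishes, the function $$I(w,x)=\frac{-w+\dfrac{U_{n-1}'(x)}{U_{n-1}(x)}-\dfrac{3x}{2(1-x^{2})}}{-w+\dfrac{T_n'(x)}{T_n(x)}-\dfrac{x}{2(1-x^{2})}}\cdot\frac{U_{n-1}(x)}{T_n(x)}\sqrt{1-x^{2}}$$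 is a first integral of the system $$\dot w=-2-4\lambda_n+(4\lambda_n-1)x^{2}-4(1-x^{2})^{2}w^{2},\qquad \dot x=4(1-x^{2})^{2}.$$ (b) Let $\mu\in\mathbb{C}$, $\mu\neq0$. On the set of all $(v,x)\in\mathbb{C}\times\Omega$ at which the denominator below does not vanish, the function $$I(v,x)=\frac{U_{n-1}'(x)(1-x^{2})+U_{n-1}(x)(\mu v-x)}{T_n'(x)(1-x^{2})+\mu\, T_n(x)\,v}\cdot\sqrt{1-x^{2}}$$ is a first integral of the system $$\dot v=\frac{\lambda_n}{\mu}(1-x^{2})-xv+\mu v^{2},\qquad \dot x=1-x^{2}.$$ -/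

import Mathlib

open Polynomial
open scoped Differential

noncomputable section

namespace ChebyshevGalois

/-! ### The differential field `ℂ(x)` -/

/-- The derivative `d/dx` of a rational function, by the quotient rule. -/
def ratDeriv (f : RatFunc ℂ) : RatFunc ℂ :=
  (algebraMap ℂ[X] (RatFunc ℂ) (derivative f.num) * algebraMap ℂ[X] (RatFunc ℂ) f.denom
    - algebraMap ℂ[X] (RatFunc ℂ) f.num * algebraMap ℂ[X] (RatFunc ℂ) (derivative f.denom))
    / algebraMap ℂ[X] (RatFunc ℂ) f.denom ^ 2

/-- The quotient rule holds for every representation as a fraction of polynomials. -/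
theorem ratDeriv_div (p q : ℂ[X]) (hq : q ≠ 0) :
    ratDeriv (algebraMap ℂ[X] (RatFunc ℂ) p / algebraMap ℂ[X] (RatFunc ℂ) q) =
      (algebraMap ℂ[X] (RatFunc ℂ) (derivative p) * algebraMap ℂ[X] (RatFunc ℂ) q
        - algebraMap ℂ[X] (RatFunc ℂ) p * algebraMap ℂ[X] (RatFunc ℂ) (derivative q))
        / algebraMap ℂ[X] (RatFunc ℂ) q ^ 2 := by
  set f : RatFunc ℂ := algebraMap ℂ[X] (RatFunc ℂ) p / algebraMap ℂ[X] (RatFunc ℂ) q with hf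
  have hd : f.denom ≠ 0 := RatFunc.denom_ne_zero f
  have hd' : algebraMap ℂ[X] (RatFunc ℂ) f.denom ≠ 0 := RatFunc.algebraMap_ne_zero hd
  have hq' : algebraMap ℂ[X] (RatFunc ℂ) q ≠ 0 := RatFunc.algebraMap_ne_zero hq
  have h1 : f.num * q = p * f.denom := by
    apply RatFunc.algebraMap_injective (K := ℂ)
    have := RatFunc.num_div_denom f
    rw [div_eq_iff hd'] at this
    rw [map_mul, map_mul, this, hf]
    field_simp
  have h2 : derivative f.num * q + f.num * derivative q
      = derivative p * f.denom + p * derivative f.denom := by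
    rw [← derivative_mul, ← derivative_mul, h1]
  have h3 : (derivative f.num * f.denom - f.num * derivative f.denom) * q ^ 2
      = (derivative p * q - p * derivative q) * f.denom ^ 2 := by
    linear_combination (f.denom * q) * h2 - (derivative f.denom * q + f.denom * derivative q) * h1
  unfold ratDeriv
  rw [div_eq_div_iff (pow_ne_zero 2 hd') (pow_ne_zero 2 hq')]
  simpa only [map_mul, map_sub, map_pow] using congrArg (algebraMap ℂ[X] (RatFunc ℂ)) h3

theorem ratDeriv_add (f g : RatFunc ℂ) : ratDeriv (f + g) = ratDeriv f + ratDeriv g := by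
  have hf : algebraMap ℂ[X] (RatFunc ℂ) f.denom ≠ 0 :=
    RatFunc.algebraMap_ne_zero (RatFunc.denom_ne_zero f)
  have hg : algebraMap ℂ[X] (RatFunc ℂ) g.denom ≠ 0 :=
    RatFunc.algebraMap_ne_zero (RatFunc.denom_ne_zero g)
  have h : f + g = algebraMap ℂ[X] (RatFunc ℂ) (f.num * g.denom + g.num * f.denom)
      / algebraMap ℂ[X] (RatFunc ℂ) (f.denom * g.denom) := by
    conv_lhs => rw [← RatFunc.num_div_denom f, ← RatFunc.num_div_denom g]
    simp only [map_mul, map_add]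
    field_simp
  rw [h, ratDeriv_div _ _ (mul_ne_zero (RatFunc.denom_ne_zero f) (RatFunc.denom_ne_zero g))]
  unfold ratDeriv
  simp only [derivative_mul, map_mul, map_add]
  field_simp
  ring

theorem ratDeriv_mul (f g : RatFunc ℂ) :
    ratDeriv (f * g) = f * ratDeriv g + g * ratDeriv f := by
  have hf : algebraMap ℂ[X] (RatFunc ℂ) f.denom ≠ 0 :=
    RatFunc.algebraMap_ne_zero (RatFunc.denom_ne_zero f)
  have hg : algebraMap ℂ[X] (RatFunc ℂ) g.denom ≠ 0 :=
    RatFunc.algebraMap_ne_zero (RatFunc.denom_ne_zero g)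
  have h : f * g = algebraMap ℂ[X] (RatFunc ℂ) (f.num * g.num)
      / algebraMap ℂ[X] (RatFunc ℂ) (f.denom * g.denom) := by
    conv_lhs => rw [← RatFunc.num_div_denom f, ← RatFunc.num_div_denom g]
    simp only [map_mul]
    field_simp
  have e : f * ratDeriv g + g * ratDeriv f =
      (algebraMap ℂ[X] (RatFunc ℂ) f.num / algebraMap ℂ[X] (RatFunc ℂ) f.denom) * ratDeriv g
      + (algebraMap ℂ[X] (RatFunc ℂ) g.num / algebraMap ℂ[X] (RatFunc ℂ) g.denom) * ratDeriv f := by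
    rw [RatFunc.num_div_denom, RatFunc.num_div_denom]
  rw [e, h, ratDeriv_div _ _ (mul_ne_zero (RatFunc.denom_ne_zero f) (RatFunc.denom_ne_zero g))]
  unfold ratDeriv
  simp only [derivative_mul, map_mul, map_add]
  field_simp
  ring

/-- The differential ring structure given by an additive map with the Leibniz rule. -/
abbrev differentialOfLeibniz {R : Type*} [CommRing R] (d : R → R)
    (hadd : ∀ a b, d (a + b) = d a + d b) (hmul : ∀ a b, d (a * b) = a * d b + b * d a) :
    Differential R where
  deriv := Derivation.mk' (AddMonoidHom.mk' d hadd).toIntLinearMap hmul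

/-- `ℂ(x)` as a differential field with the derivation `d/dx`. -/
instance ratDifferential : Differential (RatFunc ℂ) :=
  differentialOfLeibniz ratDeriv ratDeriv_add ratDeriv_mul

/-! ### Picard–Vessiot extensions and the differential Galois group -/

/-- `y` solves `y'' + a y' + b y = 0`, where `a`, `b` lie in the base field `K`. -/
def IsSolution {K L : Type*} [Field K] [Field L] [Differential L] [Algebra K L]
    (a b : K) (y : L) : Prop :=
  y′′ + algebraMap K L a * y′ + algebraMap K L b * y = 0

/-- The differential field extension `L / K` is a Picard–Vessiot extension for
`y'' + a y' + b y = 0`: it has no new constants, and it is generated over `K` as a differential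
field by two solutions that are linearly independent over the constants. -/
structure IsPicardVessiot {K : Type*} (L : Type*) [Field K] [Field L] [Differential K]
    [Differential L] [Algebra K L] [DifferentialAlgebra K L] (a b : K) : Prop where
  no_new_constants : ∀ c : L, c′ = 0 → ∃ d : K, d′ = 0 ∧ algebraMap K L d = c
  generated : ∃ y₁ y₂ : L, IsSolution a b y₁ ∧ IsSolution a b y₂ ∧
    (∀ c₁ c₂ : L, c₁′ = 0 → c₂′ = 0 → c₁ * y₁ + c₂ * y₂ = 0 → c₁ = 0 ∧ c₂ = 0) ∧
    IntermediateField.adjoin K {y₁, y₂, y₁′, y₂′} = ⊤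

/-- The differential Galois group `G(L/K)`: the `K`-automorphisms of `L` that commute with the
derivation. -/
def diffGaloisGroup (K L : Type*) [Field K] [Field L] [Differential L] [Algebra K L] :
    Subgroup (L ≃ₐ[K] L) where
  carrier := {σ | ∀ y : L, σ (y′) = (σ y)′}
  one_mem' := fun _ => rfl
  mul_mem' := by
    intro σ τ hσ hτ y
    rw [AlgEquiv.mul_apply, AlgEquiv.mul_apply, hτ, hσ]
  inv_mem' := by
    intro σ hσ y
    have key : σ.symm (y′) = (σ.symm y)′ := by
      apply σ.injective
      rw [hσ, AlgEquiv.apply_symm_apply, AlgEquiv.apply_symm_apply]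
    exact key

/-- The coefficient `-x / (1 - x²)` of `y'` in the Chebyshev equation. -/
def chebA : RatFunc ℂ := -(RatFunc.X / (1 - RatFunc.X ^ 2))

/-- The coefficient `n² / (1 - x²)` of `y` in the Chebyshev equation. -/
def chebB (n : ℕ) : RatFunc ℂ := (n : RatFunc ℂ) ^ 2 / (1 - RatFunc.X ^ 2)

/-! ### First integrals of planar complex vector fields -/

/-- `I` is a (holomorphic) first integral on the nonempty open set `D ⊆ ℂ²` of the vector field
`V`: its derivative along `V` vanishes on `D`, and it is not constant on any nonempty open
subset of `D`. -/
structure IsFirstIntegral (V : ℂ × ℂ → ℂ × ℂ) (D : Set (ℂ × ℂ)) (I : ℂ × ℂ → ℂ) : Prop where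
  isOpen : IsOpen D
  nonempty : D.Nonempty
  differentiableOn : DifferentiableOn ℂ I D
  lie_eq_zero : ∀ p ∈ D, fderiv ℂ I p (V p) = 0
  not_constant : ∀ W : Set (ℂ × ℂ), IsOpen W → W.Nonempty → W ⊆ D →
    ¬ ∃ c : ℂ, ∀ p ∈ W, I p = c

/-- `s` is a holomorphic branch of `√(1 - x²)` on the nonempty open set `Ω ⊆ ℂ`. -/
structure IsSqrtBranch (Ω : Set ℂ) (s : ℂ → ℂ) : Prop where
  isOpen : IsOpen Ω
  nonempty : Ω.Nonempty
  differentiableOn : DifferentiableOn ℂ s Ω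
  sq_eq : ∀ x ∈ Ω, s x ^ 2 = 1 - x ^ 2

/-- `T_n(x)`. -/
def chebT (n : ℕ) (x : ℂ) : ℂ := (Chebyshev.T ℂ (n : ℤ)).eval x

/-- `T_n'(x)`. -/
def chebT' (n : ℕ) (x : ℂ) : ℂ := (derivative (Chebyshev.T ℂ (n : ℤ))).eval x

/-- `U_{n-1}(x)`. -/
def chebU (n : ℕ) (x : ℂ) : ℂ := (Chebyshev.U ℂ ((n : ℤ) - 1)).eval x

/-- `U_{n-1}'(x)`. -/
def chebU' (n : ℕ) (x : ℂ) : ℂ := (derivative (Chebyshev.U ℂ ((n : ℤ) - 1))).eval x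

/-- The reduced system, in the coordinates `p = (w, x)`. -/
def reducedField (n : ℕ) (p : ℂ × ℂ) : ℂ × ℂ :=
  (-2 - 4 * (n : ℂ) ^ 2 + (4 * (n : ℂ) ^ 2 - 1) * p.2 ^ 2 - 4 * (1 - p.2 ^ 2) ^ 2 * p.1 ^ 2,
    4 * (1 - p.2 ^ 2) ^ 2)

/-- The associated quadratic system, in the coordinates `p = (v, x)`. -/
def quadraticField (n : ℕ) (μ : ℂ) (p : ℂ × ℂ) : ℂ × ℂ :=
  ((n : ℂ) ^ 2 / μ * (1 - p.2 ^ 2) - p.2 * p.1 + μ * p.1 ^ 2, 1 - p.2 ^ 2)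

/-- The denominator of the first factor of `reducedIntegral`. -/
def reducedDen (n : ℕ) (p : ℂ × ℂ) : ℂ :=
  -p.1 + chebT' n p.2 / chebT n p.2 - p.2 / (2 * (1 - p.2 ^ 2))

/-- The first integral of the reduced system, for the branch `s` of `√(1 - x²)`. -/
def reducedIntegral (n : ℕ) (s : ℂ → ℂ) (p : ℂ × ℂ) : ℂ :=
  (-p.1 + chebU' n p.2 / chebU n p.2 - 3 * p.2 / (2 * (1 - p.2 ^ 2))) / reducedDen n p
    * (chebU n p.2 / chebT n p.2) * s p.2

/-- The points over `Ω` at which no denominator in `reducedIntegral` vanishes. -/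
def reducedDomain (n : ℕ) (Ω : Set ℂ) : Set (ℂ × ℂ) :=
  {p | p.2 ∈ Ω ∧ 1 - p.2 ^ 2 ≠ 0 ∧ chebT n p.2 ≠ 0 ∧ chebU n p.2 ≠ 0 ∧ reducedDen n p ≠ 0}

/-- The denominator of `quadraticIntegral`. -/
def quadraticDen (n : ℕ) (μ : ℂ) (p : ℂ × ℂ) : ℂ :=
  chebT' n p.2 * (1 - p.2 ^ 2) + μ * chebT n p.2 * p.1

/-- The first integral of the quadratic system, for the branch `s` of `√(1 - x²)`. -/
def quadraticIntegral (n : ℕ) (μ : ℂ) (s : ℂ → ℂ) (p : ℂ × ℂ) : ℂ :=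
  (chebU' n p.2 * (1 - p.2 ^ 2) + chebU n p.2 * (μ * p.1 - p.2)) / quadraticDen n μ p * s p.2

/-- The points over `Ω` at which the denominator of `quadraticIntegral` does not vanish. -/
def quadraticDomain (n : ℕ) (μ : ℂ) (Ω : Set ℂ) : Set (ℂ × ℂ) :=
  {p | p.2 ∈ Ω ∧ quadraticDen n μ p ≠ 0}

end ChebyshevGalois

end

/-! Both `T_n(x)` and `√(1 - x²) U_{n-1}(x)` solve the Chebyshev equation: with `x = cos θ` they
are `cos nθ` and `sin nθ`, so `√(1 - x²) d/dx` rotates one into the other, up to the factor `n`.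
Together with their derivatives they generate `ℂ(x, √(1 - x²))`, which is quadratic over `ℂ(x)`
and has no new constants. Conversely, by Abel's formula the Wronskian in any Picard–Vessiot
extension is a constant multiple of `1 / √(1 - x²)`, so every such extension is this one.

Both planar systems are pulled back from the Riccati equation of the logarithmic derivative
`y' / y` of a solution. A solution `y` therefore gives the invariant curve `y' = ω y`, with a
cofactor that does not depend on `y`, and the quotient of the functions `y' - ω y` for two
independent solutions is a first integral. -/

namespace ChebyshevGalois

section Chebyshev

variable {R : Type*} [CommRing R]

theorem chebyshev_pell (n : ℤ) :
    Chebyshev.T R n ^ 2 + (1 - X ^ 2) * Chebyshev.U R (n - 1) ^ 2 = 1 := by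
  have step (k : ℤ) :
      Chebyshev.T R (k + 1) ^ 2 + (1 - X ^ 2) * Chebyshev.U R k ^ 2 =
        Chebyshev.T R k ^ 2 + (1 - X ^ 2) * Chebyshev.U R (k - 1) ^ 2 := by
    have hT := Chebyshev.T_eq_X_mul_T_sub_pol_U R (k - 1)
    have hU := Chebyshev.U_eq_X_mul_U_add_T R (k - 1)
    rw [show k - 1 + 2 = k + 1 by ring, sub_add_cancel] at hT
    rw [sub_add_cancel] at hU
    rw [hT, hU]
    ring
  induction n using Int.induction_on with
  | zero => simp
  | succ k ih => rw [add_sub_cancel_right, step, ih]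
  | pred k ih => rw [← step, sub_add_cancel, ih]

theorem one_sub_X_sq_mul_derivative_chebyshevU (n : ℤ) :
    (1 - X ^ 2) * derivative (Chebyshev.U R (n - 1)) =
      X * Chebyshev.U R (n - 1) - (n : R[X]) * Chebyshev.T R n := by
  have h := Chebyshev.add_one_mul_T_eq_poly_in_U (R := R) (n - 1)
  rw [sub_add_cancel] at h
  push_cast at h
  linear_combination h

end Chebyshev

section Wronskian

variable {K L : Type*} [Field L] [Differential L]

/-- The Wronskian of two elements of a differential ring, which decides their linear independence
over the constants. -/
def wronskian {R : Type*} [CommRing R] [Differential R] (y z : R) : R :=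
  y * z′ - y′ * z

theorem deriv_div_eq_zero_of_deriv_eq_mul {g v w : L} (hv : v′ = g * v) (hw : w′ = g * w) :
    (v / w)′ = 0 := by
  rw [Derivation.leibniz_div, hv, hw]
  simp only [smul_eq_mul]
  ring

theorem wronskian_ne_zero_iff {y z : L} :
    wronskian y z ≠ 0 ↔
      ∀ c₁ c₂ : L, c₁′ = 0 → c₂′ = 0 → c₁ * y + c₂ * z = 0 → c₁ = 0 ∧ c₂ = 0 := by
  constructor
  · intro hW c₁ c₂ h₁ h₂ h
    have h' : c₁ * y′ + c₂ * z′ = 0 := by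
      simpa [h₁, h₂] using congrArg (fun u : L => u′) h
    constructor
    · refine (mul_eq_zero.mp ?_).resolve_right hW
      rw [wronskian]
      linear_combination z′ * h - z * h'
    · refine (mul_eq_zero.mp ?_).resolve_right hW
      rw [wronskian]
      linear_combination y * h' - y′ * h
  · intro hind hW
    have hy : y ≠ 0 := by
      rintro rfl
      exact one_ne_zero (hind 1 0 (by simp) (by simp) (by simp)).1
    have hzy : (z / y)′ = 0 := by
      rw [wronskian] at hW
      rw [Derivation.leibniz_div]
      simp only [smul_eq_mul]
      rw [mul_comm z, hW, mul_zero]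
    have h := hind (-(z / y)) 1 (by rw [map_neg, hzy, neg_zero]) (by simp) (by field_simp; simp)
    exact one_ne_zero h.2

variable [Field K] [Algebra K L] {a b : K} {u v z : L}

theorem IsSolution.deriv_wronskian (hu : IsSolution a b u) (hv : IsSolution a b v) :
    (wronskian u v)′ = -algebraMap K L a * wronskian u v := by
  rw [IsSolution] at hu hv
  simp only [wronskian, map_sub, Derivation.leibniz, smul_eq_mul]
  linear_combination u * hv - v * hu

/-- Cramer's rule expresses `z` and `z′` through quotients of Wronskians, which are constants by
Abel's formula. -/
theorem IsSolution.exists_eq_const_combination (hu : IsSolution a b u) (hv : IsSolution a b v)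
    (hW : wronskian u v ≠ 0) (hz : IsSolution a b z) :
    ∃ c₁ c₂ : L, c₁′ = 0 ∧ c₂′ = 0 ∧ z = c₁ * u + c₂ * v ∧ z′ = c₁ * u′ + c₂ * v′ := by
  refine ⟨wronskian z v / wronskian u v, wronskian u z / wronskian u v,
    deriv_div_eq_zero_of_deriv_eq_mul (hz.deriv_wronskian hv) (hu.deriv_wronskian hv),
    deriv_div_eq_zero_of_deriv_eq_mul (hu.deriv_wronskian hz) (hu.deriv_wronskian hv), ?_, ?_⟩
  all_goals
    field_simp
    simp only [wronskian]
    ring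

variable (K) in
theorem wronskian_mem_adjoin (u v : L) :
    wronskian u v ∈ IntermediateField.adjoin K {u, v, u′, v′} := by
  have mem_gen {t : L} (ht : t ∈ ({u, v, u′, v′} : Set L)) :
      t ∈ IntermediateField.adjoin K {u, v, u′, v′} :=
    IntermediateField.subset_adjoin K _ ht
  exact sub_mem (mul_mem (mem_gen (by simp)) (mem_gen (by simp)))
    (mul_mem (mem_gen (by simp)) (mem_gen (by simp)))

variable [Differential K] [DifferentialAlgebra K L]

theorem IsPicardVessiot.adjoin_eq_top (h : IsPicardVessiot L a b) (hu : IsSolution a b u)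
    (hv : IsSolution a b v) (hW : wronskian u v ≠ 0) :
    IntermediateField.adjoin K {u, v, u′, v′} = ⊤ := by
  obtain ⟨y, z, hy, hz, -, htop⟩ := h.generated
  set F := IntermediateField.adjoin K {u, v, u′, v′}
  have mem_gen {t : L} (ht : t ∈ ({u, v, u′, v′} : Set L)) : t ∈ F :=
    IntermediateField.subset_adjoin K _ ht
  have mem_const {c : L} (hc : c′ = 0) : c ∈ F := by
    obtain ⟨d, -, rfl⟩ := h.no_new_constants c hc
    exact F.algebraMap_mem d
  have mem_solution {t : L} (ht : IsSolution a b t) : t ∈ F ∧ t′ ∈ F := by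
    obtain ⟨c₁, c₂, h₁, h₂, htuv, htuv'⟩ := hu.exists_eq_const_combination hv hW ht
    rw [htuv', htuv]
    exact ⟨add_mem (mul_mem (mem_const h₁) (mem_gen (by simp)))
        (mul_mem (mem_const h₂) (mem_gen (by simp))),
      add_mem (mul_mem (mem_const h₁) (mem_gen (by simp)))
        (mul_mem (mem_const h₂) (mem_gen (by simp)))⟩
  rw [eq_top_iff, ← htop, IntermediateField.adjoin_le_iff]
  rintro t (rfl | rfl | rfl | rfl)
  exacts [(mem_solution hy).1, (mem_solution hz).1, (mem_solution hy).2, (mem_solution hz).2]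

/-- Since `a = q′ / (2 q)`, Abel's formula makes `q W ^ 2` a constant for every Wronskian `W`. -/
theorem IsPicardVessiot.exists_sq_eq (k : Type*) [Field k] [IsAlgClosed k] [Algebra k K]
    [Differential.ContainConstants k K] (h : IsPicardVessiot L a b) {q : K}
    (hq : q′ = 2 * a * q) : ∃ s : L, s ^ 2 = algebraMap K L q := by
  obtain ⟨y, z, hy, hz, hind, -⟩ := h.generated
  have hW := wronskian_ne_zero_iff.mpr hind
  have hconst : (algebraMap K L q * wronskian y z ^ 2)′ = 0 := by
    rw [Derivation.leibniz, Derivation.leibniz_pow, deriv_algebraMap, hq, hy.deriv_wronskian hz]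
    simp only [map_mul, map_ofNat, smul_eq_mul]
    ring
  obtain ⟨d, hd, hdq⟩ := h.no_new_constants _ hconst
  obtain ⟨c, rfl⟩ := mem_range_of_deriv_eq_zero k hd
  obtain ⟨r, rfl⟩ := IsAlgClosed.exists_pow_nat_eq c two_pos
  refine ⟨algebraMap K L (algebraMap k K r) / wronskian y z, ?_⟩
  rw [div_pow, div_eq_iff (pow_ne_zero 2 hW), ← hdq, map_pow, map_pow]

end Wronskian

section Constants

variable {K L : Type*} [Field K] [Differential K] [Field L] [Differential L] [Algebra K L]
  [DifferentialAlgebra K L]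

theorem mapCoeffs_minpoly_eq_zero {c : L} (hint : IsIntegral K c) (hc : c′ = 0) :
    Differential.mapCoeffs (minpoly K c) = 0 := by
  have hmon := minpoly.monic hint
  have hroot : aeval c (Differential.mapCoeffs (minpoly K c)) = 0 := by
    simpa [hc] using (Differential.deriv_aeval_eq c (minpoly K c)).symm
  have hdeg : (Differential.mapCoeffs (minpoly K c)).degree < (minpoly K c).degree := by
    rw [degree_eq_natDegree hmon.ne_zero, degree_lt_iff_coeff_zero]
    intro m hm
    rw [Differential.coeff_mapCoeffs]
    obtain rfl | hlt := hm.eq_or_lt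
    · simp [hmon.coeff_natDegree]
    · simp [coeff_eq_zero_of_natDegree_lt hlt]
  by_contra hne
  exact (minpoly.degree_le_of_ne_zero K c hne hroot).not_gt hdeg

theorem exists_algebraMap_eq_of_deriv_eq_zero (k : Type*) [Field k] [IsAlgClosed k] [Algebra k K]
    [Differential.ContainConstants k K] {c : L} (hint : IsIntegral K c) (hc : c′ = 0) :
    ∃ r : k, algebraMap K L (algebraMap k K r) = c := by
  have hlift : minpoly K c ∈ lifts (algebraMap k K) := by
    rw [lifts_iff_coeff_lifts]
    intro i
    refine mem_range_of_deriv_eq_zero k ?_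
    rw [← Differential.coeff_mapCoeffs, mapCoeffs_minpoly_eq_zero hint hc, coeff_zero]
  obtain ⟨p, hp⟩ := hlift
  replace hp : p.map (algebraMap k K) = minpoly K c := hp
  have hdeg : p.degree ≠ 0 := by
    rw [← degree_map p (algebraMap k K), hp]
    exact (minpoly.degree_pos hint).ne'
  obtain ⟨r, hr⟩ := IsAlgClosed.exists_root p hdeg
  exact ⟨r, minpoly.root hint (hp ▸ hr.map)⟩

end Constants

section Quadratic

variable {K L : Type*} [Field K] [Field L] [Algebra K L]

theorem irreducible_X_sq_sub_C {d : K} (hd : ¬IsSquare d) : Irreducible (X ^ 2 - C d) :=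
  X_pow_sub_C_irreducible_of_prime Nat.prime_two fun b hb => hd ⟨b, by rw [← hb, sq]⟩

theorem isQuadraticExtension_of_sq_eq {d : K} (hd : ¬IsSquare d) {s : L}
    (hs : s ^ 2 = algebraMap K L d) (htop : IntermediateField.adjoin K {s} = ⊤) :
    Algebra.IsQuadraticExtension K L := by
  have hmon : (X ^ 2 - C d).Monic := monic_X_pow_sub_C d two_ne_zero
  have hroot : aeval s (X ^ 2 - C d) = 0 := by simp [hs]
  have hmin := minpoly.eq_of_irreducible_of_monic (irreducible_X_sq_sub_C hd) hroot hmon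
  constructor
  rw [← IntermediateField.finrank_top', ← htop,
    IntermediateField.adjoin.finrank ⟨_, hmon, hroot⟩, ← hmin, natDegree_X_pow_sub_C]

variable [Differential K] [Differential L] [DifferentialAlgebra K L]

theorem diffGaloisGroup_eq_top [Algebra.IsSeparable K L] : diffGaloisGroup K L = ⊤ :=
  eq_top_iff.mpr fun σ _ y => Differential.algEquiv_deriv' σ y

theorem nonempty_diffGaloisGroup_mulEquiv [Algebra.IsSeparable K L]
    [Algebra.IsQuadraticExtension K L] :
    Nonempty (diffGaloisGroup K L ≃* Multiplicative (ZMod 2)) := by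
  have hcard : Nat.card (diffGaloisGroup K L) = 2 := by
    rw [diffGaloisGroup_eq_top, Subgroup.card_top, IsGalois.card_aut_eq_finrank,
      Algebra.IsQuadraticExtension.finrank_eq_two]
  exact ⟨mulEquivOfPrimeCardEq (p := 2) hcard (by simp)⟩

end Quadratic

section ChebyshevSolutions

theorem deriv_eval_chebyshevT {R : Type*} [CommRing R] [Differential R] (t : R) (n : ℤ) :
    ((Chebyshev.T R n).eval t)′ = n * (Chebyshev.U R (n - 1)).eval t * t′ := by
  rw [← Chebyshev.aeval_T (R := ℤ), Derivation.map_aeval, Chebyshev.T_derivative_eq_U]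
  simp

theorem deriv_eval_chebyshevU {R : Type*} [CommRing R] [Differential R] (t : R) (n : ℤ) :
    (1 - t ^ 2) * ((Chebyshev.U R (n - 1)).eval t)′ =
      (t * (Chebyshev.U R (n - 1)).eval t - n * (Chebyshev.T R n).eval t) * t′ := by
  have h := congrArg (aeval t) (one_sub_X_sq_mul_derivative_chebyshevU (R := ℤ) n)
  simp only [map_mul, map_sub, map_one, map_pow, map_intCast, aeval_X, Chebyshev.aeval_T,
    Chebyshev.aeval_U] at h
  rw [← h, ← Chebyshev.aeval_U (R := ℤ), Derivation.map_aeval, smul_eq_mul]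
  ring

theorem eval_chebyshev_pell {R : Type*} [CommRing R] (t : R) (n : ℤ) :
    (Chebyshev.T R n).eval t ^ 2 + (1 - t ^ 2) * (Chebyshev.U R (n - 1)).eval t ^ 2 = 1 := by
  simpa using congrArg (eval t) (chebyshev_pell (R := R) n)

section Sqrt

variable {L : Type*} [Field L] [Differential L] [CharZero L] {s t : L}

theorem sqrt_mul_deriv (ht : t′ = 1) (hs : s ^ 2 = 1 - t ^ 2) : s * s′ = -t := by
  have h := congrArg (fun y : L => y′) hs
  simp only [Derivation.leibniz_pow, map_sub, Derivation.map_one_eq_zero, ht] at h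
  refine mul_left_cancel₀ (two_ne_zero (α := L)) ?_
  linear_combination h

theorem sqrt_ne_zero (ht : t′ = 1) (hs : s ^ 2 = 1 - t ^ 2) : s ≠ 0 := by
  rintro rfl
  have ht0 : t = 0 := by simpa using sqrt_mul_deriv ht hs
  simp [ht0] at ht

theorem sqrt_mul_deriv_eval_chebyshevU (ht : t′ = 1) (hs : s ^ 2 = 1 - t ^ 2) (n : ℤ) :
    s * ((Chebyshev.U L (n - 1)).eval t * s)′ = -(n * (Chebyshev.T L n).eval t) := by
  have hU := deriv_eval_chebyshevU t n
  rw [ht, ← hs] at hU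
  rw [Derivation.leibniz, smul_eq_mul, smul_eq_mul]
  linear_combination hU + (Chebyshev.U L (n - 1)).eval t * sqrt_mul_deriv ht hs

theorem sqrt_mul_wronskian_chebyshev (ht : t′ = 1) (hs : s ^ 2 = 1 - t ^ 2) (n : ℤ) :
    s * wronskian ((Chebyshev.T L n).eval t) ((Chebyshev.U L (n - 1)).eval t * s) = -n := by
  have hT := deriv_eval_chebyshevT t n
  have hU := sqrt_mul_deriv_eval_chebyshevU ht hs n
  have hpell := eval_chebyshev_pell t n
  rw [ht] at hT
  rw [← hs] at hpell
  rw [wronskian, hT]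
  linear_combination (Chebyshev.T L n).eval t * hU - n * hpell

theorem wronskian_chebyshev_ne_zero (ht : t′ = 1) (hs : s ^ 2 = 1 - t ^ 2) {n : ℤ}
    (hn : n ≠ 0) :
    wronskian ((Chebyshev.T L n).eval t) ((Chebyshev.U L (n - 1)).eval t * s) ≠ 0 := by
  refine right_ne_zero_of_mul (a := s) ?_
  rw [sqrt_mul_wronskian_chebyshev ht hs, neg_ne_zero]
  exact Int.cast_ne_zero.mpr hn

end Sqrt

variable {K L : Type*} [Field K] [Differential K] [Field L] [Differential L] [Algebra K L]
  [DifferentialAlgebra K L] [CharZero L] {x : K} {s : L}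

/-- `y` and `z` behave like `cos νθ` and `sin νθ` with `x = cos θ` and `s = sin θ`. -/
theorem isSolution_of_rotation {ν : K} (hν : ν′ = 0) (hx : x′ = 1)
    (hs : s ^ 2 = 1 - algebraMap K L x ^ 2) {y z : L} (hy : s * y′ = algebraMap K L ν * z)
    (hz : s * z′ = -(algebraMap K L ν * y)) :
    IsSolution (-(x / (1 - x ^ 2))) (ν ^ 2 / (1 - x ^ 2)) y := by
  have ht : (algebraMap K L x)′ = 1 := by rw [deriv_algebraMap, hx, map_one]
  have hs0 := sqrt_ne_zero ht hs
  have hderiv := congrArg (fun u : L => u′) hy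
  simp only [Derivation.leibniz, deriv_algebraMap, hν, map_zero, smul_eq_mul, mul_zero,
    add_zero] at hderiv
  have heq : s ^ 2 * y′′ - algebraMap K L x * y′ + algebraMap K L ν ^ 2 * y = 0 := by
    linear_combination s * hderiv + algebraMap K L ν * hz - y′ * sqrt_mul_deriv ht hs
  rw [IsSolution]
  simp only [map_neg, map_div₀, map_sub, map_one, map_pow, ← hs]
  field_simp
  linear_combination heq

theorem isSolution_chebyshevT (hx : x′ = 1) (hs : s ^ 2 = 1 - algebraMap K L x ^ 2) (n : ℤ) :
    IsSolution (-(x / (1 - x ^ 2))) ((n : K) ^ 2 / (1 - x ^ 2))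
      ((Chebyshev.T L n).eval (algebraMap K L x)) := by
  have ht : (algebraMap K L x)′ = 1 := by rw [deriv_algebraMap, hx, map_one]
  refine isSolution_of_rotation (Derivation.map_intCast _ n) hx hs
    (z := (Chebyshev.U L (n - 1)).eval (algebraMap K L x) * s) ?_ ?_
  · rw [deriv_eval_chebyshevT, ht, map_intCast]
    ring
  · rw [sqrt_mul_deriv_eval_chebyshevU ht hs, map_intCast]

theorem isSolution_chebyshevU_mul_sqrt (hx : x′ = 1) (hs : s ^ 2 = 1 - algebraMap K L x ^ 2)
    (n : ℤ) :
    IsSolution (-(x / (1 - x ^ 2))) ((n : K) ^ 2 / (1 - x ^ 2))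
      ((Chebyshev.U L (n - 1)).eval (algebraMap K L x) * s) := by
  have ht : (algebraMap K L x)′ = 1 := by rw [deriv_algebraMap, hx, map_one]
  refine isSolution_of_rotation (Derivation.map_intCast _ n) hx hs
    (z := -(Chebyshev.T L n).eval (algebraMap K L x)) ?_ ?_
  · rw [sqrt_mul_deriv_eval_chebyshevU ht hs, map_intCast, mul_neg]
  · rw [map_neg, deriv_eval_chebyshevT, ht, map_intCast]
    ring

theorem adjoin_chebyshev_eq_adjoin_sqrt (hx : x′ = 1) (hs : s ^ 2 = 1 - algebraMap K L x ^ 2)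
    {n : ℤ} (hn : n ≠ 0) :
    IntermediateField.adjoin K
      {(Chebyshev.T L n).eval (algebraMap K L x),
        (Chebyshev.U L (n - 1)).eval (algebraMap K L x) * s,
        ((Chebyshev.T L n).eval (algebraMap K L x))′,
        ((Chebyshev.U L (n - 1)).eval (algebraMap K L x) * s)′} =
      IntermediateField.adjoin K {s} := by
  have ht : (algebraMap K L x)′ = 1 := by rw [deriv_algebraMap, hx, map_one]
  have hs0 := sqrt_ne_zero ht hs
  apply le_antisymm
  · have hsmem := IntermediateField.mem_adjoin_simple_self K s
    have hT : (Chebyshev.T L n).eval (algebraMap K L x) ∈ IntermediateField.adjoin K {s} := by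
      rw [← Chebyshev.algebraMap_eval_T]
      exact IntermediateField.algebraMap_mem _ _
    have hU : (Chebyshev.U L (n - 1)).eval (algebraMap K L x) ∈
        IntermediateField.adjoin K {s} := by
      rw [← Chebyshev.algebraMap_eval_U]
      exact IntermediateField.algebraMap_mem _ _
    have hV' := eq_div_of_mul_eq hs0
      ((mul_comm _ s).trans (sqrt_mul_deriv_eval_chebyshevU ht hs n))
    rw [IntermediateField.adjoin_le_iff, deriv_eval_chebyshevT, ht, mul_one, hV']
    rintro _ (rfl | rfl | rfl | rfl)
    exacts [hT, mul_mem hU hsmem, mul_mem (intCast_mem _ n) hU,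
      div_mem (neg_mem (mul_mem (intCast_mem _ n) hT)) hsmem]
  · have hW := wronskian_chebyshev_ne_zero ht hs hn
    rw [IntermediateField.adjoin_simple_le_iff]
    convert div_mem (neg_mem (intCast_mem _ n)) (wronskian_mem_adjoin K
      ((Chebyshev.T L n).eval (algebraMap K L x))
      ((Chebyshev.U L (n - 1)).eval (algebraMap K L x) * s))
    exact eq_div_of_mul_eq hW (sqrt_mul_wronskian_chebyshev ht hs n)

theorem isPicardVessiot_chebyshev_of_adjoin_eq_top (k : Type*) [Field k] [IsAlgClosed k]
    [Algebra k K] [Differential.ContainConstants k K] (hx : x′ = 1)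
    (hs : s ^ 2 = 1 - algebraMap K L x ^ 2) (htop : IntermediateField.adjoin K {s} = ⊤)
    {n : ℤ} (hn : n ≠ 0) :
    IsPicardVessiot L (-(x / (1 - x ^ 2))) ((n : K) ^ 2 / (1 - x ^ 2)) where
  no_new_constants c hc := by
    have hsint : IsIntegral K s :=
      ⟨X ^ 2 - C (1 - x ^ 2), monic_X_pow_sub_C _ two_ne_zero, by simp [hs]⟩
    have hcint : IsIntegral K c := by
      have := IntermediateField.isAlgebraic_adjoin_simple hsint
      have hcmem : c ∈ IntermediateField.adjoin K {s} := by simp [htop]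
      exact IntermediateField.isIntegral_iff.mp (Algebra.IsIntegral.isIntegral ⟨c, hcmem⟩)
    obtain ⟨r, rfl⟩ := exists_algebraMap_eq_of_deriv_eq_zero k hcint hc
    refine ⟨algebraMap k K r, ?_, rfl⟩
    rwa [deriv_algebraMap, map_eq_zero] at hc
  generated := by
    have ht : (algebraMap K L x)′ = 1 := by rw [deriv_algebraMap, hx, map_one]
    exact ⟨_, _, isSolution_chebyshevT hx hs n, isSolution_chebyshevU_mul_sqrt hx hs n,
      wronskian_ne_zero_iff.mp (wronskian_chebyshev_ne_zero ht hs hn),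
      (adjoin_chebyshev_eq_adjoin_sqrt hx hs hn).trans htop⟩

theorem IsPicardVessiot.exists_sqrt_adjoin_eq_top (k : Type*) [Field k] [IsAlgClosed k]
    [Algebra k K] [Differential.ContainConstants k K] (hx : x′ = 1) {n : ℤ} (hn : n ≠ 0)
    (h : IsPicardVessiot L (-(x / (1 - x ^ 2))) ((n : K) ^ 2 / (1 - x ^ 2))) :
    ∃ s : L, s ^ 2 = algebraMap K L (1 - x ^ 2) ∧ IntermediateField.adjoin K {s} = ⊤ := by
  have hq : (1 - x ^ 2)′ = 2 * -(x / (1 - x ^ 2)) * (1 - x ^ 2) := by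
    obtain h0 | h0 := eq_or_ne (1 - x ^ 2) 0
    · simp [h0]
    · simp only [map_sub, Derivation.map_one_eq_zero, Derivation.leibniz_pow, hx]
      field_simp
      simp
  obtain ⟨s, hs⟩ := h.exists_sq_eq k hq
  refine ⟨s, hs, ?_⟩
  have ht : (algebraMap K L x)′ = 1 := by rw [deriv_algebraMap, hx, map_one]
  rw [map_sub, map_one, map_pow] at hs
  rw [← adjoin_chebyshev_eq_adjoin_sqrt hx hs hn]
  exact h.adjoin_eq_top (isSolution_chebyshevT hx hs n) (isSolution_chebyshevU_mul_sqrt hx hs n)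
    (wronskian_chebyshev_ne_zero ht hs hn)

theorem IsPicardVessiot.nonempty_diffGaloisGroup_chebyshev (k : Type*) [Field k] [IsAlgClosed k]
    [Algebra k K] [Differential.ContainConstants k K] (hx : x′ = 1) (hsq : ¬IsSquare (1 - x ^ 2))
    {n : ℤ} (hn : n ≠ 0)
    (h : IsPicardVessiot L (-(x / (1 - x ^ 2))) ((n : K) ^ 2 / (1 - x ^ 2))) :
    Nonempty (diffGaloisGroup K L ≃* Multiplicative (ZMod 2)) := by
  have : CharZero K := (algebraMap K L).charZero
  obtain ⟨s, hs, htop⟩ := h.exists_sqrt_adjoin_eq_top k hx hn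
  have := isQuadraticExtension_of_sq_eq hsq hs htop
  exact nonempty_diffGaloisGroup_mulEquiv

theorem exists_isPicardVessiot_chebyshev.{u, v} {K : Type u} [Field K] [Differential K] [CharZero K]
    (k : Type v) [Field k] [IsAlgClosed k] [Algebra k K] [Differential.ContainConstants k K]
    {x : K} (hx : x′ = 1) (hsq : ¬IsSquare (1 - x ^ 2)) {n : ℤ} (hn : n ≠ 0) :
    ∃ (L : Type u) (_ : Field L) (_ : Differential L) (_ : Algebra K L)
      (_ : DifferentialAlgebra K L),
      IsPicardVessiot L (-(x / (1 - x ^ 2))) ((n : K) ^ 2 / (1 - x ^ 2)) := by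
  let p : K[X] := X ^ 2 - C (1 - x ^ 2)
  have hirr : Fact (Irreducible p) := ⟨irreducible_X_sq_sub_C hsq⟩
  have hmon : Fact p.Monic := ⟨monic_X_pow_sub_C _ two_ne_zero⟩
  have := charZero_of_injective_algebraMap (algebraMap K (AdjoinRoot p)).injective
  have hroot : AdjoinRoot.root p ^ 2 = 1 - algebraMap K (AdjoinRoot p) x ^ 2 := by
    have h : aeval (AdjoinRoot.root p) p = 0 := by rw [AdjoinRoot.aeval_eq, AdjoinRoot.mk_self]
    simpa [p, sub_eq_zero] using h
  exact ⟨AdjoinRoot p, inferInstance, inferInstance, inferInstance, inferInstance,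
    isPicardVessiot_chebyshev_of_adjoin_eq_top k hx hroot
      (IntermediateField.adjoin_root_eq_top p) hn⟩

end ChebyshevSolutions

section RationalFunctions

theorem deriv_algebraMap_polynomial (p : ℂ[X]) :
    (algebraMap ℂ[X] (RatFunc ℂ) p)′ = algebraMap ℂ[X] (RatFunc ℂ) (derivative p) := by
  have h := ratDeriv_div p 1 one_ne_zero
  simp only [map_one, div_one, derivative_one, map_zero, mul_one, mul_zero, sub_zero,
    one_pow] at h
  exact h

theorem deriv_ratFuncX : (RatFunc.X : RatFunc ℂ)′ = 1 := by
  rw [← RatFunc.algebraMap_X, deriv_algebraMap_polynomial, derivative_X, map_one]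

instance containConstants_ratFunc : Differential.ContainConstants ℂ (RatFunc ℂ) where
  mem_range_of_deriv_eq_zero {f} hf := by
    have hden := RatFunc.algebraMap_ne_zero f.denom_ne_zero
    have hwronskian : Polynomial.wronskian f.num f.denom = 0 := by
      have hf' : ratDeriv f = 0 := hf
      rw [ratDeriv, div_eq_zero_iff, or_iff_left (pow_ne_zero 2 hden), ← map_mul, ← map_mul,
        ← map_sub, map_eq_zero_iff _ (RatFunc.algebraMap_injective ℂ)] at hf'
      rw [Polynomial.wronskian]
      linear_combination -hf'
    obtain ⟨hnum', hden'⟩ := f.isCoprime_num_denom.wronskian_eq_zero_iff.mp hwronskian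
    obtain ⟨a, ha⟩ := natDegree_eq_zero.mp (derivative_eq_zero.mp hnum')
    obtain ⟨b, hb⟩ := natDegree_eq_zero.mp (derivative_eq_zero.mp hden')
    refine ⟨a / b, ?_⟩
    rw [← f.num_div_denom, ← ha, ← hb, RatFunc.algebraMap_C, RatFunc.algebraMap_C, ← map_div₀,
      RatFunc.algebraMap_eq_C]

theorem not_isSquare_one_sub_ratFuncX_sq {F : Type*} [Field F] [NeZero (2 : F)] :
    ¬IsSquare (1 - RatFunc.X ^ 2 : RatFunc F) := by
  rintro ⟨f, hff⟩
  have hf : f ^ 2 = algebraMap F[X] (RatFunc F) (1 - X ^ 2) := by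
    simp [sq, ← hff, RatFunc.algebraMap_X]
  obtain ⟨p, rfl⟩ := IsIntegrallyClosed.exists_algebraMap_eq_of_isIntegral_pow
    (R := F[X]) two_pos (hf ▸ isIntegral_algebraMap)
  have hp : p ^ 2 = 1 - X ^ 2 := RatFunc.algebraMap_injective F (by rw [map_pow, hf])
  have hroot : eval 1 p = 0 := by simpa using congrArg (eval 1) hp
  have hderiv := congrArg (fun q => eval 1 (derivative q)) hp
  exact two_ne_zero (α := F) (by simpa [derivative_pow, hroot] using hderiv)

end RationalFunctions

section FirstIntegrals

variable {V : ℂ × ℂ → ℂ × ℂ} {D : Set (ℂ × ℂ)}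

theorem IsFirstIntegral.congr {I J : ℂ × ℂ → ℂ} (h : IsFirstIntegral V D I) (hIJ : D.EqOn J I) :
    IsFirstIntegral V D J where
  isOpen := h.isOpen
  nonempty := h.nonempty
  differentiableOn := h.differentiableOn.congr hIJ
  lie_eq_zero p hp := by
    rw [(hIJ.eventuallyEq_of_mem (h.isOpen.mem_nhds hp)).fderiv_eq]
    exact h.lie_eq_zero p hp
  not_constant W hW hne hWD := fun ⟨c, hc⟩ =>
    h.not_constant W hW hne hWD ⟨c, fun p hp => (hIJ (hWD hp)).symm.trans (hc p hp)⟩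

theorem isFirstIntegral_of_hasFDerivAt {I : ℂ × ℂ → ℂ} {I' : ℂ × ℂ → ℂ × ℂ →L[ℂ] ℂ}
    (hopen : IsOpen D) (hne : D.Nonempty) (hI : ∀ p ∈ D, HasFDerivAt I (I' p) p)
    (hV : ∀ p ∈ D, I' p (V p) = 0) (hI' : ∀ p ∈ D, I' p ≠ 0) : IsFirstIntegral V D I where
  isOpen := hopen
  nonempty := hne
  differentiableOn p hp := (hI p hp).differentiableAt.differentiableWithinAt
  lie_eq_zero p hp := by rw [(hI p hp).fderiv, hV p hp]
  not_constant := by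
    rintro W hW ⟨p, hp⟩ hWD ⟨c, hc⟩
    have hconst : I =ᶠ[nhds p] fun _ => c := Filter.mem_of_superset (hW.mem_nhds hp) hc
    refine hI' p (hWD hp) ?_
    rw [← (hI p (hWD hp)).fderiv, hconst.fderiv_eq, fderiv_fun_const, Pi.zero_apply]

theorem hasFDerivAt_fun_div {𝕜 E : Type*} [NontriviallyNormedField 𝕜] [NormedAddCommGroup E]
    [NormedSpace 𝕜 E] {P Q : E → 𝕜} {P' Q' : E →L[𝕜] 𝕜} {p : E} (hP : HasFDerivAt P P' p)
    (hQ : HasFDerivAt Q Q' p) (hQ0 : Q p ≠ 0) :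
    HasFDerivAt (fun p => P p / Q p) ((Q p ^ 2)⁻¹ • (Q p • P' - P p • Q')) p := by
  have hinv : HasFDerivAt (fun p => (Q p)⁻¹) (-(Q p ^ 2)⁻¹ • Q') p :=
    (hasDerivAt_inv hQ0).comp_hasFDerivAt p hQ
  simp only [div_eq_mul_inv]
  refine (hP.fun_mul hinv).congr_fderiv ?_
  ext v
  simp only [add_apply, smul_apply, sub_apply, smul_eq_mul]
  field_simp
  ring

/-- Darboux's method, with `g` the common cofactor of `P` and `Q` along `V`. -/
theorem isFirstIntegral_div_of_cofactor {P Q g : ℂ × ℂ → ℂ} {P' Q' : ℂ × ℂ → ℂ × ℂ →L[ℂ] ℂ}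
    (hopen : IsOpen D) (hne : D.Nonempty) (hP : ∀ p ∈ D, HasFDerivAt P (P' p) p)
    (hQ : ∀ p ∈ D, HasFDerivAt Q (Q' p) p) (hPV : ∀ p ∈ D, P' p (V p) = g p * P p)
    (hQV : ∀ p ∈ D, Q' p (V p) = g p * Q p) (hQ0 : ∀ p ∈ D, Q p ≠ 0)
    (hPQ : ∀ p ∈ D, Q p • P' p - P p • Q' p ≠ 0) :
    IsFirstIntegral V D (fun p => P p / Q p) := by
  refine isFirstIntegral_of_hasFDerivAt hopen hne
    (fun p hp => hasFDerivAt_fun_div (hP p hp) (hQ p hp) (hQ0 p hp)) (fun p hp => ?_) fun p hp => ?_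
  · simp only [smul_apply, sub_apply, smul_eq_mul,
      hPV p hp, hQV p hp]
    ring
  · exact smul_ne_zero (inv_ne_zero (pow_ne_zero 2 (hQ0 p hp))) (hPQ p hp)

/-- `y` is a holomorphic solution of `y'' + a y' + b y = 0` on `Ω`; the derivative `y'` of `y` is
carried along as a separate function, so that it can be given by a formula. -/
structure IsSolutionOn (Ω : Set ℂ) (a b y y' : ℂ → ℂ) : Prop where
  hasDerivAt : ∀ x ∈ Ω, HasDerivAt y (y' x) x
  hasDerivAt_deriv : ∀ x ∈ Ω, HasDerivAt y' (-(a x * y' x + b x * y x)) x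

theorem IsSolutionOn.hasFDerivAt_deriv_sub_mul {Ω : Set ℂ} {a b y y' : ℂ → ℂ}
    (h : IsSolutionOn Ω a b y y') {ω : ℂ × ℂ → ℂ} {ω' : ℂ × ℂ →L[ℂ] ℂ} {p : ℂ × ℂ}
    (hp : p.2 ∈ Ω) (hω : HasFDerivAt ω ω' p) :
    HasFDerivAt (fun p : ℂ × ℂ => y' p.2 - ω p * y p.2)
      (-(a p.2 * y' p.2 + b p.2 * y p.2) • ContinuousLinearMap.snd ℂ ℂ ℂ -
        (ω p • y' p.2 • ContinuousLinearMap.snd ℂ ℂ ℂ + y p.2 • ω')) p :=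
  ((h.hasDerivAt_deriv p.2 hp).comp_hasFDerivAt p hasFDerivAt_snd).sub
    (hω.mul ((h.hasDerivAt p.2 hp).comp_hasFDerivAt p hasFDerivAt_snd))

/-- The hypothesis on `ω` says that it pulls `V` back to the Riccati equation
`ω' = -(ω² + a ω + b)` of the logarithmic derivatives `y' / y`. Each curve `y' = ω y` is therefore
invariant, with cofactor `-(V p).2 * (a + ω)`. -/
theorem isFirstIntegral_of_riccati {Ω : Set ℂ} {a b y₁ y₁' y₂ y₂' : ℂ → ℂ}
    (h₁ : IsSolutionOn Ω a b y₁ y₁') (h₂ : IsSolutionOn Ω a b y₂ y₂')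
    (hW : ∀ x ∈ Ω, y₁ x * y₂' x - y₁' x * y₂ x ≠ 0) {ω : ℂ × ℂ → ℂ}
    {ω' : ℂ × ℂ → ℂ × ℂ →L[ℂ] ℂ} (hopen : IsOpen D) (hne : D.Nonempty)
    (hDΩ : ∀ p ∈ D, p.2 ∈ Ω) (hω : ∀ p ∈ D, HasFDerivAt ω (ω' p) p)
    (hriccati : ∀ p ∈ D, ω' p (V p) = -((V p).2 * (ω p ^ 2 + a p.2 * ω p + b p.2)))
    (hω' : ∀ p ∈ D, ω' p (1, 0) ≠ 0) (hden : ∀ p ∈ D, y₂' p.2 - ω p * y₂ p.2 ≠ 0) :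
    IsFirstIntegral V D
      (fun p => (y₁' p.2 - ω p * y₁ p.2) / (y₂' p.2 - ω p * y₂ p.2)) := by
  refine isFirstIntegral_div_of_cofactor (g := fun p => -((V p).2 * (a p.2 + ω p))) hopen hne
    (fun p hp => h₁.hasFDerivAt_deriv_sub_mul (hDΩ p hp) (hω p hp))
    (fun p hp => h₂.hasFDerivAt_deriv_sub_mul (hDΩ p hp) (hω p hp)) ?_ ?_ hden ?_
  · intro p hp
    simp only [neg_add_rev, sub_apply, smul_apply, ContinuousLinearMap.coe_snd', smul_eq_mul,
      add_apply, hriccati p hp, mul_neg, neg_mul]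
    ring
  · intro p hp
    simp only [neg_add_rev, sub_apply, smul_apply, ContinuousLinearMap.coe_snd', smul_eq_mul,
      add_apply, hriccati p hp, mul_neg, neg_mul]
    ring
  · intro p hp h0
    have h := DFunLike.congr_fun h0 (1, 0)
    simp only [neg_add_rev, sub_apply, smul_apply, ContinuousLinearMap.coe_snd', smul_eq_mul,
      mul_zero, add_apply, zero_add, zero_sub, mul_neg, sub_neg_eq_add, zero_apply] at h
    refine mul_ne_zero (hω' p hp) (hW p.2 (hDΩ p hp)) ?_
    linear_combination -h

end FirstIntegrals

section ChebyshevFirstIntegrals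

theorem exists_mem_eval_ne_zero {R : Type*} [CommRing R] [IsDomain R] {S : Set R}
    (hS : S.Infinite) {p : R[X]} (hp : p ≠ 0) : ∃ x ∈ S, eval x p ≠ 0 := by
  by_contra! h
  exact hp (eq_zero_of_infinite_isRoot p (hS.mono h))

theorem hasDerivAt_chebT (n : ℕ) (x : ℂ) : HasDerivAt (chebT n) (n * chebU n x) x := by
  have h := (Chebyshev.T ℂ (n : ℤ)).hasDerivAt x
  rwa [Chebyshev.T_derivative_eq_U, eval_mul, Int.cast_natCast, eval_natCast] at h

theorem chebT'_eq (n : ℕ) (x : ℂ) : chebT' n x = n * chebU n x :=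
  ((Chebyshev.T ℂ (n : ℤ)).hasDerivAt x).unique (hasDerivAt_chebT n x)

theorem one_sub_sq_mul_chebU' (n : ℕ) (x : ℂ) :
    (1 - x ^ 2) * chebU' n x = x * chebU n x - n * chebT n x := by
  simpa only [chebU', chebU, chebT, eval_mul, eval_sub, eval_one, eval_pow, eval_X,
    Int.cast_natCast, eval_natCast]
    using congrArg (eval x) (one_sub_X_sq_mul_derivative_chebyshevU (R := ℂ) n)

theorem isOpen_quadraticDomain (n : ℕ) (μ : ℂ) {Ω : Set ℂ} (hΩ : IsOpen Ω) :
    IsOpen (quadraticDomain n μ Ω) := by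
  have hT : Continuous (chebT n) := Polynomial.continuous _
  have hT' : Continuous (chebT' n) := Polynomial.continuous _
  have hden : Continuous (quadraticDen n μ) := by
    unfold quadraticDen
    fun_prop
  exact (hΩ.preimage continuous_snd).inter (isOpen_ne.preimage hden)

theorem isOpen_reducedDomain (n : ℕ) {Ω : Set ℂ} (hΩ : IsOpen Ω) :
    IsOpen (reducedDomain n Ω) := by
  have hT : Continuous (chebT n) := Polynomial.continuous _
  have hT' : Continuous (chebT' n) := Polynomial.continuous _
  have hU : Continuous (chebU n) := Polynomial.continuous _
  let E : Set (ℂ × ℂ) := {p | p.2 ∈ Ω ∧ 1 - p.2 ^ 2 ≠ 0 ∧ chebT n p.2 ≠ 0 ∧ chebU n p.2 ≠ 0}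
  have hE : IsOpen E := (hΩ.preimage continuous_snd).inter
    ((isOpen_ne_fun (by fun_prop) continuous_const).inter
      ((isOpen_ne_fun (by fun_prop) continuous_const).inter
        (isOpen_ne_fun (by fun_prop) continuous_const)))
  have hden : ContinuousOn (reducedDen n) E := by
    rintro p ⟨-, hq, hT0, -⟩
    have hq : 2 * (1 - p.2 ^ 2) ≠ 0 := mul_ne_zero two_ne_zero hq
    unfold reducedDen
    exact ContinuousAt.continuousWithinAt (by fun_prop (disch := assumption))
  convert hden.isOpen_inter_preimage hE (isOpen_ne (x := 0)) using 1
  ext p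
  simp [reducedDomain, E, and_assoc]

theorem nonempty_quadraticDomain (n : ℕ) {μ : ℂ} (hμ : μ ≠ 0) {Ω : Set ℂ} (hΩ : Ω.Infinite) :
    (quadraticDomain n μ Ω).Nonempty := by
  obtain ⟨x, hx, (hT : chebT n x ≠ 0)⟩ := exists_mem_eval_ne_zero hΩ (Chebyshev.T_ne_zero ℂ n)
  refine ⟨((1 - chebT' n x * (1 - x ^ 2)) / (μ * chebT n x), x), hx, ?_⟩
  rw [quadraticDen, mul_div_cancel₀ _ (mul_ne_zero hμ hT), add_sub_cancel]
  exact one_ne_zero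

theorem nonempty_reducedDomain {n : ℕ} (hn : n ≠ 0) {Ω : Set ℂ} (hΩ : Ω.Infinite)
    (hq : ∀ x ∈ Ω, 1 - x ^ 2 ≠ 0) : (reducedDomain n Ω).Nonempty := by
  have hU := Chebyshev.U_ne_zero ℂ ((n : ℤ) - 1) (by omega)
  obtain ⟨x, hx, hTU⟩ := exists_mem_eval_ne_zero hΩ (mul_ne_zero (Chebyshev.T_ne_zero ℂ n) hU)
  rw [eval_mul, mul_ne_zero_iff] at hTU
  obtain ⟨w, hw⟩ : ∃ w, reducedDen n (w, x) = 1 := by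
    refine ⟨chebT' n x / chebT n x - x / (2 * (1 - x ^ 2)) - 1, ?_⟩
    rw [reducedDen]
    ring
  exact ⟨(w, x), hx, hq x hx, hTU.1, hTU.2, hw.trans_ne one_ne_zero⟩

/-- The logarithmic derivative `y' / y` in the coordinates of the quadratic system, where
`v = -(1 - x²) y' / (μ y)`. -/
noncomputable def quadraticLogDeriv (μ : ℂ) (p : ℂ × ℂ) : ℂ :=
  -(μ * p.1 / (1 - p.2 ^ 2))

/-- The logarithmic derivative `y' / y` in the coordinates of the reduced system, where `w` is the
logarithmic derivative of `(1 - x²)^(1/4) y`, which satisfies an equation without first-order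
term. -/
noncomputable def reducedLogDeriv (p : ℂ × ℂ) : ℂ :=
  p.1 + p.2 / (2 * (1 - p.2 ^ 2))

theorem hasFDerivAt_one_sub_snd_sq (p : ℂ × ℂ) :
    HasFDerivAt (fun p : ℂ × ℂ => 1 - p.2 ^ 2)
      (-(2 * p.2) • ContinuousLinearMap.snd ℂ ℂ ℂ) p := by
  have h : HasDerivAt (fun x : ℂ => 1 - x ^ 2) (-(2 * p.2)) p.2 := by
    simpa using (hasDerivAt_pow 2 p.2).const_sub 1
  exact h.comp_hasFDerivAt p hasFDerivAt_snd

theorem hasFDerivAt_quadraticLogDeriv (μ : ℂ) {p : ℂ × ℂ} (hq : 1 - p.2 ^ 2 ≠ 0) :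
    HasFDerivAt (quadraticLogDeriv μ)
      (-((μ / (1 - p.2 ^ 2)) • ContinuousLinearMap.fst ℂ ℂ ℂ +
        (2 * μ * p.1 * p.2 / (1 - p.2 ^ 2) ^ 2) • ContinuousLinearMap.snd ℂ ℂ ℂ)) p := by
  refine (hasFDerivAt_fun_div (hasFDerivAt_fst.const_mul μ) (hasFDerivAt_one_sub_snd_sq p)
    hq).fun_neg.congr_fderiv (congrArg Neg.neg (ContinuousLinearMap.ext fun v => ?_))
  simp only [add_apply, sub_apply, smul_apply, ContinuousLinearMap.coe_fst',
    ContinuousLinearMap.coe_snd', smul_eq_mul]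
  field_simp
  ring

theorem hasFDerivAt_reducedLogDeriv {p : ℂ × ℂ} (hq : 1 - p.2 ^ 2 ≠ 0) :
    HasFDerivAt reducedLogDeriv
      (ContinuousLinearMap.fst ℂ ℂ ℂ +
        ((1 + p.2 ^ 2) / (2 * (1 - p.2 ^ 2) ^ 2)) • ContinuousLinearMap.snd ℂ ℂ ℂ) p := by
  refine (hasFDerivAt_fst.fun_add (hasFDerivAt_fun_div hasFDerivAt_snd
    ((hasFDerivAt_one_sub_snd_sq p).const_mul 2) (mul_ne_zero two_ne_zero hq))).congr_fderiv
    (congrArg (_ + ·) (ContinuousLinearMap.ext fun v => ?_))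
  simp only [sub_apply, smul_apply, ContinuousLinearMap.coe_snd', smul_eq_mul]
  field_simp
  ring

theorem quadraticDen_eq (n : ℕ) (μ : ℂ) {p : ℂ × ℂ} (hq : 1 - p.2 ^ 2 ≠ 0) :
    quadraticDen n μ p =
      (1 - p.2 ^ 2) * (n * chebU n p.2 - quadraticLogDeriv μ p * chebT n p.2) := by
  rw [quadraticDen, chebT'_eq, quadraticLogDeriv]
  field_simp
  ring

theorem reducedDen_eq (n : ℕ) {p : ℂ × ℂ} (hT : chebT n p.2 ≠ 0) :
    reducedDen n p = (n * chebU n p.2 - reducedLogDeriv p * chebT n p.2) / chebT n p.2 := by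
  rw [reducedDen, chebT'_eq, reducedLogDeriv]
  field_simp
  ring

namespace IsSqrtBranch

variable {Ω : Set ℂ} {s : ℂ → ℂ}

theorem mul_deriv (h : IsSqrtBranch Ω s) {x : ℂ} (hx : x ∈ Ω) : s x * deriv s x = -x := by
  have hs := (h.differentiableOn.differentiableAt (h.isOpen.mem_nhds hx)).hasDerivAt
  have hsq : (fun y => 1 - y ^ 2) =ᶠ[nhds x] fun y => s y ^ 2 :=
    Filter.mem_of_superset (h.isOpen.mem_nhds hx) fun y hy => (h.sq_eq y hy).symm
  have heq := ((hs.fun_pow 2).congr_of_eventuallyEq hsq).unique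
    ((hasDerivAt_pow 2 x).const_sub 1)
  refine mul_left_cancel₀ (two_ne_zero (α := ℂ)) ?_
  simpa [mul_assoc] using heq

theorem ne_zero (h : IsSqrtBranch Ω s) {x : ℂ} (hx : x ∈ Ω) : s x ≠ 0 := by
  intro hs
  have hx0 : x = 0 := by simpa [hs] using h.mul_deriv hx
  have hsq := h.sq_eq x hx
  rw [hs, hx0] at hsq
  norm_num at hsq

theorem one_sub_sq_ne_zero (h : IsSqrtBranch Ω s) {x : ℂ} (hx : x ∈ Ω) : 1 - x ^ 2 ≠ 0 := by
  rw [← h.sq_eq x hx]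
  exact pow_ne_zero 2 (h.ne_zero hx)

theorem hasDerivAt (h : IsSqrtBranch Ω s) {x : ℂ} (hx : x ∈ Ω) : HasDerivAt s (-x / s x) x := by
  rw [← eq_div_of_mul_eq (h.ne_zero hx) ((mul_comm _ _).trans (h.mul_deriv hx))]
  exact (h.differentiableOn.differentiableAt (h.isOpen.mem_nhds hx)).hasDerivAt

theorem hasDerivAt_chebU (h : IsSqrtBranch Ω s) (n : ℕ) {x : ℂ} (hx : x ∈ Ω) :
    HasDerivAt (chebU n) ((x * chebU n x - n * chebT n x) / (1 - x ^ 2)) x := by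
  rw [← eq_div_of_mul_eq (h.one_sub_sq_ne_zero hx)
    ((mul_comm _ _).trans (one_sub_sq_mul_chebU' n x))]
  exact (Chebyshev.U ℂ ((n : ℤ) - 1)).hasDerivAt x

theorem isSolutionOn_chebT (h : IsSqrtBranch Ω s) (n : ℕ) :
    IsSolutionOn Ω (fun x => -(x / (1 - x ^ 2))) (fun x => (n : ℂ) ^ 2 / (1 - x ^ 2))
      (chebT n) (fun x => n * chebU n x) where
  hasDerivAt x _ := hasDerivAt_chebT n x
  hasDerivAt_deriv x hx := by
    refine ((h.hasDerivAt_chebU n hx).const_mul (n : ℂ)).congr_deriv ?_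
    ring

theorem isSolutionOn_chebU_mul (h : IsSqrtBranch Ω s) (n : ℕ) :
    IsSolutionOn Ω (fun x => -(x / (1 - x ^ 2))) (fun x => (n : ℂ) ^ 2 / (1 - x ^ 2))
      (fun x => chebU n x * s x) (fun x => -(n * chebT n x) / s x) where
  hasDerivAt x hx := by
    have hs0 := h.ne_zero hx
    refine ((h.hasDerivAt_chebU n hx).fun_mul (h.hasDerivAt hx)).congr_deriv ?_
    rw [← h.sq_eq x hx]
    field_simp
    ring
  hasDerivAt_deriv x hx := by
    have hs0 := h.ne_zero hx
    refine (((hasDerivAt_chebT n x).const_mul (n : ℂ)).fun_neg.fun_div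
      (h.hasDerivAt hx) hs0).congr_deriv ?_
    rw [← h.sq_eq x hx]
    field_simp
    ring

theorem wronskian_ne_zero (h : IsSqrtBranch Ω s) {n : ℕ} (hn : n ≠ 0) {x : ℂ} (hx : x ∈ Ω) :
    chebU n x * s x * (n * chebU n x) - -(n * chebT n x) / s x * chebT n x ≠ 0 := by
  have hs0 := h.ne_zero hx
  have hpell : chebT n x ^ 2 + s x ^ 2 * chebU n x ^ 2 = 1 := by
    rw [h.sq_eq x hx]
    exact eval_chebyshev_pell x n
  have hW : chebU n x * s x * (n * chebU n x) - -(n * chebT n x) / s x * chebT n x = n / s x := by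
    field_simp
    linear_combination hpell
  rw [hW]
  exact div_ne_zero (Nat.cast_ne_zero.mpr hn) hs0

theorem quadratic_numerator_mul_eq (h : IsSqrtBranch Ω s) (n : ℕ) (μ : ℂ) {p : ℂ × ℂ}
    (hp : p.2 ∈ Ω) :
    (chebU' n p.2 * (1 - p.2 ^ 2) + chebU n p.2 * (μ * p.1 - p.2)) * s p.2 =
      (1 - p.2 ^ 2) *
        (-(n * chebT n p.2) / s p.2 - quadraticLogDeriv μ p * (chebU n p.2 * s p.2)) := by
  have hs := h.ne_zero hp
  rw [quadraticLogDeriv, mul_comm (chebU' n p.2), one_sub_sq_mul_chebU', ← h.sq_eq _ hp]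
  field_simp
  ring

theorem reduced_numerator_mul_eq (h : IsSqrtBranch Ω s) (n : ℕ) {p : ℂ × ℂ} (hp : p.2 ∈ Ω)
    (hU : chebU n p.2 ≠ 0) :
    (-p.1 + chebU' n p.2 / chebU n p.2 - 3 * p.2 / (2 * (1 - p.2 ^ 2))) * chebU n p.2 * s p.2 =
      -(n * chebT n p.2) / s p.2 - reducedLogDeriv p * (chebU n p.2 * s p.2) := by
  have hs := h.ne_zero hp
  have hU' := one_sub_sq_mul_chebU' n p.2
  rw [← h.sq_eq _ hp] at hU'
  rw [reducedLogDeriv, ← h.sq_eq _ hp]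
  field_simp
  linear_combination 2 * hU'

theorem isFirstIntegral_quadratic (h : IsSqrtBranch Ω s) {n : ℕ} (hn : n ≠ 0) {μ : ℂ}
    (hμ : μ ≠ 0) :
    IsFirstIntegral (quadraticField n μ) (quadraticDomain n μ Ω) (quadraticIntegral n μ s) := by
  have hΩ := infinite_of_mem_nhds _ (h.isOpen.mem_nhds h.nonempty.some_mem)
  have hq {p : ℂ × ℂ} (hp : p ∈ quadraticDomain n μ Ω) : 1 - p.2 ^ 2 ≠ 0 :=
    h.one_sub_sq_ne_zero hp.1
  refine (isFirstIntegral_of_riccati (h.isSolutionOn_chebU_mul n) (h.isSolutionOn_chebT n)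
    (fun x hx => h.wronskian_ne_zero hn hx) (isOpen_quadraticDomain n μ h.isOpen)
    (nonempty_quadraticDomain n hμ hΩ) (fun p hp => hp.1)
    (fun p hp => hasFDerivAt_quadraticLogDeriv μ (hq hp)) ?_ ?_ ?_).congr ?_
  · intro p hp
    have hq := hq hp
    simp only [quadraticField, quadraticLogDeriv, neg_apply, add_apply, smul_apply,
      ContinuousLinearMap.coe_fst', ContinuousLinearMap.coe_snd', smul_eq_mul]
    field_simp
    ring
  · intro p hp
    simpa using div_ne_zero hμ (hq hp)
  · intro p hp
    exact right_ne_zero_of_mul (quadraticDen_eq n μ (hq hp) ▸ hp.2)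
  · intro p hp
    beta_reduce
    rw [quadraticIntegral, div_mul_eq_mul_div, h.quadratic_numerator_mul_eq n μ hp.1,
      quadraticDen_eq n μ (hq hp), mul_div_mul_left _ _ (hq hp)]

theorem isFirstIntegral_reduced (h : IsSqrtBranch Ω s) {n : ℕ} (hn : n ≠ 0) :
    IsFirstIntegral (reducedField n) (reducedDomain n Ω) (reducedIntegral n s) := by
  have hΩ := infinite_of_mem_nhds _ (h.isOpen.mem_nhds h.nonempty.some_mem)
  refine (isFirstIntegral_of_riccati (h.isSolutionOn_chebU_mul n) (h.isSolutionOn_chebT n)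
    (fun x hx => h.wronskian_ne_zero hn hx) (isOpen_reducedDomain n h.isOpen)
    (nonempty_reducedDomain hn hΩ fun x hx => h.one_sub_sq_ne_zero hx) (fun p hp => hp.1)
    (fun p hp => hasFDerivAt_reducedLogDeriv hp.2.1) ?_ ?_ ?_).congr ?_
  · rintro p ⟨-, hq, -⟩
    simp only [reducedField, reducedLogDeriv, add_apply, smul_apply,
      ContinuousLinearMap.coe_fst', ContinuousLinearMap.coe_snd', smul_eq_mul]
    field_simp
    ring
  · intro p _
    simp
  · rintro p ⟨-, -, hT, -, hden⟩ h0
    rw [reducedDen_eq n hT, h0, zero_div] at hden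
    exact hden rfl
  · rintro p ⟨hp, -, hT, hU, -⟩
    beta_reduce
    rw [reducedIntegral, ← h.reduced_numerator_mul_eq n hp hU, reducedDen_eq n hT]
    field_simp

end IsSqrtBranch

end ChebyshevFirstIntegrals

end ChebyshevGalois

theorem mainTheorem3 (n : ℕ) (hn : 1 ≤ n) :
    -- a Picard–Vessiot extension of `ℂ(x)` for the Chebyshev equation exists, and
    -- for every such extension the differential Galois group is `ℤ/2`
    (∃ (L : Type) (_ : Field L) (_ : Differential L) (_ : Algebra (RatFunc ℂ) L)
        (_ : DifferentialAlgebra (RatFunc ℂ) L),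
        ChebyshevGalois.IsPicardVessiot L ChebyshevGalois.chebA (ChebyshevGalois.chebB n)) ∧
    (∀ (L : Type*) [Field L] [Differential L] [Algebra (RatFunc ℂ) L]
        [DifferentialAlgebra (RatFunc ℂ) L],
        ChebyshevGalois.IsPicardVessiot L ChebyshevGalois.chebA (ChebyshevGalois.chebB n) →
        Nonempty (ChebyshevGalois.diffGaloisGroup (RatFunc ℂ) L ≃* Multiplicative (ZMod 2))) ∧
    -- the first integrals, for every local holomorphic branch `s` of `√(1 - x²)`
    (∀ (Ω : Set ℂ) (s : ℂ → ℂ), ChebyshevGalois.IsSqrtBranch Ω s →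
        ChebyshevGalois.IsFirstIntegral (ChebyshevGalois.reducedField n)
          (ChebyshevGalois.reducedDomain n Ω) (ChebyshevGalois.reducedIntegral n s)) ∧
    (∀ (μ : ℂ), μ ≠ 0 → ∀ (Ω : Set ℂ) (s : ℂ → ℂ), ChebyshevGalois.IsSqrtBranch Ω s →
        ChebyshevGalois.IsFirstIntegral (ChebyshevGalois.quadraticField n μ)
          (ChebyshevGalois.quadraticDomain n μ Ω) (ChebyshevGalois.quadraticIntegral n μ s)) := by
  have hn0 : n ≠ 0 := Nat.one_le_iff_ne_zero.mp hn
  have hn0' : (n : ℤ) ≠ 0 := Nat.cast_ne_zero.mpr hn0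
  have hB : ChebyshevGalois.chebB n = ((n : ℤ) : RatFunc ℂ) ^ 2 / (1 - RatFunc.X ^ 2) := by
    rw [Int.cast_natCast, ChebyshevGalois.chebB]
  rw [hB, ChebyshevGalois.chebA]
  refine ⟨?_, fun L _ _ _ _ h => ?_, fun Ω s h => h.isFirstIntegral_reduced hn0,
    fun μ hμ Ω s h => h.isFirstIntegral_quadratic hn0 hμ⟩
  · exact ChebyshevGalois.exists_isPicardVessiot_chebyshev ℂ ChebyshevGalois.deriv_ratFuncX
      ChebyshevGalois.not_isSquare_one_sub_ratFuncX_sq hn0'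
  · have := charZero_of_injective_algebraMap (algebraMap (RatFunc ℂ) L).injective
    exact h.nonempty_diffGaloisGroup_chebyshev ℂ ChebyshevGalois.deriv_ratFuncX
      ChebyshevGalois.not_isSquare_one_sub_ratFuncX_sq hn0'
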